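/- Let $X$ be a path connected, locally path connected, semilocally simply connected, locally compact, Hausdorff and second countable space. Let $\Pi_1(X)$ be its fundamental groupoid: its arrows are the classes of paths in $X$ modulo endpoint-fixing homotopy, the source and range of $[\gamma]$ are $s([\gamma])=\gamma(0)$ and $r([\gamma])=\gamma(1)$, the product $[\gamma][\eta]$ (for $\gamma(0)=\eta(1)$) is the class of the path that runs first along $\eta$ and then along $\gamma$, and $\Pi_1(X)$ carries the quotient topology of the compact-open topology on the space of all paths $C([0,1],X)$. Then $\Pi_1(X)$ is a locally compact Hausdorff topological groupoid, and it has a Haar system. That is, writing $G=\Pi_1(X)$, with space of units $G^{(0)}$ (the classes of constant paths, with the subspace topology) and $G^x=r^{-1}(x)$, there is a family $(\alpha^x)_{x\in G^{(0)}}$ of Radon measures on $G$ such that 1. the support of $\alpha^x$ is $G^x$ for every $x\in G^{(0)}$; 2. for every $f\in C_c(G)$ the function $x\mapsto\int_G f\,d\alpha^x$ is in $C_c(G^{(0)})$; 3. for every $f\in C_c(G)$ and every $\gamma\in G$, $$\int_{G^{s(\gamma)}} f(\gamma\eta)\,d\alpha^{s(\gamma)}(\eta)=\int_{G^{r(\gamma)}}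 f(\eta)\,d\alpha^{r(\gamma)}(\eta).$$ -/

import Mathlib

open CategoryTheory MeasureTheory Topology

universe u v

/-! ### Topological groupoids

A groupoid is a small category in which every arrow is invertible; its set of arrows is
`Arrow C`. For an arrow `γ`, the source is `s γ = γ.left` and the range is `r γ = γ.right`.
Products are written in the right-to-left convention: `γ η` is defined when `s γ = r η`, and it
is "first `η`, then `γ`". -/

section Groupoids

variable (C : Type u) [Groupoid.{v} C]

/-- The space of units of a groupoid whose set of arrows carries a topology: the topology on the
set of units which identifies a unit `x` with the arrow `𝟙 x` and gives the units the subspace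
topology. -/
@[reducible] def unitTopology [TopologicalSpace (Arrow C)] : TopologicalSpace C :=
  TopologicalSpace.induced (fun x : C => Arrow.mk (𝟙 x)) inferInstance

attribute [local instance] unitTopology

variable {C}

/-- The product `γ η` of two composable arrows, `s γ = r η`. -/
def arrowMul (γ η : Arrow C) (h : η.right = γ.left) : Arrow C :=
  Arrow.mk (η.hom ≫ eqToHom h ≫ γ.hom : η.left ⟶ γ.right)

/-- The inverse of an arrow. -/
def arrowInv (γ : Arrow C) : Arrow C :=
  Arrow.mk (Groupoid.inv γ.hom : γ.right ⟶ γ.left)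

/-- The range fibre `G^x`, the set of arrows with range `x`. -/
def rangeFibre (x : C) : Set (Arrow C) := {γ | γ.right = x}

variable (C)

/-- A topological groupoid: source, range, inversion and multiplication are continuous, where the
units carry the subspace topology and the composable pairs the subspace topology of the
product. -/
structure IsTopologicalGroupoid [TopologicalSpace (Arrow C)] : Prop where
  continuous_source : Continuous (fun γ : Arrow C => (γ.left : C))
  continuous_range : Continuous (fun γ : Arrow C => (γ.right : C))
  continuous_inv : Continuous (arrowInv : Arrow C → Arrow C)
  continuous_mul : Continuous
    (fun p : {p : Arrow C × Arrow C // p.2.right = p.1.left} => arrowMul p.1.1 p.1.2 p.2)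

/-- A (left) Haar system on a locally compact Hausdorff groupoid: a family `α^x`, indexed by the
units, of Radon (regular Borel) measures on the space of arrows such that
* the support of `α^x` is the whole range fibre `G^x`;
* for every `f ∈ C_c(G)`, the function `x ↦ ∫ f dα^x` is in `C_c(G⁰)`;
* `∫_{G^{s γ}} f (γ η) dα^{s γ}(η) = ∫ f (η) dα^{r γ}(η)` for all `γ` and all `f ∈ C_c(G)`. -/
structure HaarSystem [TopologicalSpace (Arrow C)] [MeasurableSpace (Arrow C)]
    [BorelSpace (Arrow C)] where
  measure : C → Measure (Arrow C)
  regular : ∀ x, (measure x).Regular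
  support_eq : ∀ x, (measure x).support = rangeFibre x
  continuous_integral : ∀ f : Arrow C → ℂ, Continuous f → HasCompactSupport f →
    Continuous (fun x : C => ∫ η, f η ∂(measure x))
  hasCompactSupport_integral : ∀ f : Arrow C → ℂ, Continuous f → HasCompactSupport f →
    HasCompactSupport (fun x : C => ∫ η, f η ∂(measure x))
  left_invariant : ∀ f : Arrow C → ℂ, Continuous f → HasCompactSupport f → ∀ γ : Arrow C,
    ∫ η : rangeFibre γ.left, f (arrowMul γ η.1 η.2) ∂((measure γ.left).comap Subtype.val)
      = ∫ η, f η ∂(measure γ.right)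

end Groupoids

/-! ### The topological fundamental groupoid -/

section Fundamental

variable (X : Type u) [TopologicalSpace X]

/-- Semilocally simply connected: every point `x` has a neighbourhood `U` such that every loop in
`U` based at `x` is null-homotopic in `X`. -/
def SemilocallySimplyConnected : Prop :=
  ∀ x : X, ∃ U ∈ 𝓝 x, ∀ γ : Path x x, Set.range γ ⊆ U → γ.Homotopic (Path.refl x)

variable {X}

/-- The arrow of the fundamental groupoid given by the endpoint-fixing homotopy class of a path;
its source is the initial point `p 0` and its range is the terminal point `p 1`. -/
noncomputable def pathClass (p : C(unitInterval, X)) : Arrow (FundamentalGroupoid X) :=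
  Arrow.mk (FundamentalGroupoid.fromPath
    (Path.Homotopic.Quotient.mk (⟨p, rfl, rfl⟩ : Path (p 0) (p 1))))

/-- The topology of the fundamental groupoid: the quotient topology induced by the compact-open
topology on the space of all paths in `X`. -/
noncomputable instance fundamentalGroupoidTopology : TopologicalSpace (Arrow (FundamentalGroupoid X)) :=
  TopologicalSpace.coinduced pathClass inferInstance

noncomputable instance fundamentalGroupoidMeasurableSpace : MeasurableSpace (Arrow (FundamentalGroupoid X)) :=
  borel _

instance fundamentalGroupoidBorelSpace : BorelSpace (Arrow (FundamentalGroupoid X)) := ⟨rfl⟩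

end Fundamental

-- Call an open path connected set elementary if its paths are determined up to homotopy in `X` by
-- their endpoints; the hypotheses on `X` make such sets a basis. Composing an arrow `γ` with short
-- paths in elementary `U` and `V` at its two ends gives a sheet, and an arrow of a sheet is
-- determined by its endpoints, which range over `U × V`. The main topological point is that sheets
-- are a neighbourhood basis for the quotient topology (`exists_sheet_subset`, `isOpen_sheet`).
-- Hence the endpoint map to `X × X` is a local homeomorphism, and local compactness, the Hausdorff
-- property and continuity of the product are read off from sheets.
--
-- For the Haar system, take a finite atomic measure on `X` with positive masses at a dense
-- sequence, and lift it along the source map `G^x → X`: every arrow from `d n` to `x` gets mass `c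
-- n`. Left translation keeps sources, so it permutes the atoms without changing weights, whence
-- invariance. Continuity in `x` then follows from invariance: integrals over nearby fibres are
-- pulled back to one fixed fibre by short arrows, and dominated convergence applies
-- (`continuous_integral_liftMeasure`).

attribute [local instance] unitTopology

namespace FundamentalGroupoid

/-! ### Elementary sets and sheets. -/

section Local

variable {X : Type u} [TopologicalSpace X]

/-- A homotopy class of paths is supported in `U` if it is the class of a path in `U`. -/
def SupportedIn (U : Set X) {x y : FundamentalGroupoid X} (h : x ⟶ y) : Prop :=
  ∃ p : Path x.as y.as, Set.range p ⊆ U ∧ h = Path.Homotopic.Quotient.mk p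

/-- An open path connected set in which any two paths with the same endpoints are homotopic in the
ambient space. -/
structure IsElementary (U : Set X) : Prop where
  isOpen : IsOpen U
  isPathConnected : IsPathConnected U
  homotopic : ∀ (x y : X) (p q : Path x y), Set.range p ⊆ U → Set.range q ⊆ U → p.Homotopic q

variable {U V W : Set X} {x y z : FundamentalGroupoid X}

lemma SupportedIn.mono {h : x ⟶ y} (hh : SupportedIn U h) (hUV : U ⊆ V) : SupportedIn V h :=
  let ⟨p, hp, e⟩ := hh
  ⟨p, hp.trans hUV, e⟩

lemma SupportedIn.id (hx : x.as ∈ U) : SupportedIn U (𝟙 x) := by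
  refine ⟨Path.refl _, ?_, rfl⟩
  rintro _ ⟨t, rfl⟩
  exact hx

lemma SupportedIn.comp {h : x ⟶ y} {k : y ⟶ z} (hh : SupportedIn U h) (hk : SupportedIn U k) :
    SupportedIn U (h ≫ k) := by
  obtain ⟨p, hp, rfl⟩ := hh
  obtain ⟨q, hq, rfl⟩ := hk
  refine ⟨p.trans q, ?_, rfl⟩
  rw [Path.trans_range]
  exact Set.union_subset hp hq

lemma SupportedIn.inv {h : x ⟶ y} (hh : SupportedIn U h) : SupportedIn U (Groupoid.inv h) := by
  obtain ⟨p, hp, rfl⟩ := hh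
  refine ⟨p.symm, ?_, rfl⟩
  rwa [Path.symm_range]

lemma SupportedIn.left_mem {h : x ⟶ y} (hh : SupportedIn U h) : x.as ∈ U := by
  obtain ⟨p, hp, -⟩ := hh
  exact hp ⟨0, p.source⟩

lemma SupportedIn.right_mem {h : x ⟶ y} (hh : SupportedIn U h) : y.as ∈ U := by
  obtain ⟨p, hp, -⟩ := hh
  exact hp ⟨1, p.target⟩

lemma IsElementary.eq (hU : IsElementary U) {h k : x ⟶ y} (hh : SupportedIn U h)
    (hk : SupportedIn U k) : h = k := by
  obtain ⟨p, hp, rfl⟩ := hh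
  obtain ⟨q, hq, rfl⟩ := hk
  exact Path.Homotopic.Quotient.eq.2 (hU.homotopic _ _ p q hp hq)

lemma IsElementary.exists_supportedIn (hU : IsElementary U) (hx : x.as ∈ U) (hy : y.as ∈ U) :
    ∃ h : x ⟶ y, SupportedIn U h := by
  obtain ⟨p, hp⟩ := hU.isPathConnected.joinedIn _ hx _ hy
  exact ⟨Path.Homotopic.Quotient.mk p, p, by rintro _ ⟨t, rfl⟩; exact hp t, rfl⟩

/-- In a locally path connected, semilocally simply connected space, the elementary open sets
form a basis. -/
lemma exists_isElementary [LocallyPathConnectedSpace X] (hX : SemilocallySimplyConnected X)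
    {x : X} {W : Set X} (hW : W ∈ 𝓝 x) : ∃ U, IsElementary U ∧ x ∈ U ∧ U ⊆ W := by
  obtain ⟨S, hS, hSl⟩ := hX x
  obtain ⟨U, ⟨hUo, hxU, hUc⟩, hUW⟩ :=
    (isOpen_isPathConnected_basis x).mem_iff.1 (Filter.inter_mem hW hS)
  refine ⟨U, ⟨hUo, hUc, fun a b p q hp hq => ?_⟩, hxU, fun z hz => (hUW hz).1⟩
  obtain ⟨r, hr⟩ := hUc.joinedIn _ hxU _ (hp ⟨0, p.source⟩)
  have hr' : Set.range r ⊆ U := by rintro _ ⟨t, rfl⟩; exact hr t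
  -- Only loops based at `x` are known to contract, so `p` and `q` are joined to `x` by the tail
  -- `r`, which is cancelled afterwards.
  have hl := hSl ((r.trans p).trans (r.trans q).symm) (by
    rw [Path.trans_range, Path.symm_range, Path.trans_range, Path.trans_range]
    exact (Set.union_subset (Set.union_subset hr' hp) (Set.union_subset hr' hq)).trans
      fun z hz => (hUW hz).2)
  rw [← fromPath_eq_iff_homotopic] at hl ⊢
  let P : FundamentalGroupoid.mk a ⟶ .mk b := fromPath (.mk p)
  let Q : FundamentalGroupoid.mk a ⟶ .mk b := fromPath (.mk q)
  let R : FundamentalGroupoid.mk x ⟶ .mk a := fromPath (.mk r)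
  have hl' : (R ≫ P) ≫ Groupoid.inv (R ≫ Q) = 𝟙 _ := hl
  rw [Groupoid.inv_eq_inv, IsIso.comp_inv_eq, Category.id_comp] at hl'
  exact (cancel_epi R).1 hl'

/-- The arrows obtained from `γ` by composing with short paths in `U` and `V`. -/
def sheet (γ : Arrow (FundamentalGroupoid X)) (U V : Set X) :
    Set (Arrow (FundamentalGroupoid X)) :=
  {η | ∃ (a : η.left ⟶ γ.left) (b : γ.right ⟶ η.right),
    SupportedIn U a ∧ SupportedIn V b ∧ η.hom = a ≫ γ.hom ≫ b}

variable {γ η : Arrow (FundamentalGroupoid X)}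

lemma sheet_mono {U' V' : Set X} (hU : U ⊆ U') (hV : V ⊆ V') : sheet γ U V ⊆ sheet γ U' V' := by
  rintro η ⟨a, b, ha, hb, e⟩
  exact ⟨a, b, ha.mono hU, hb.mono hV, e⟩

lemma mem_sheet_self (hU : γ.left.as ∈ U) (hV : γ.right.as ∈ V) : γ ∈ sheet γ U V :=
  ⟨𝟙 _, 𝟙 _, .id hU, .id hV, by simp⟩

lemma left_mem_of_mem_sheet (h : η ∈ sheet γ U V) : η.left.as ∈ U :=
  let ⟨_, _, ha, _, _⟩ := h
  ha.left_mem

lemma right_mem_of_mem_sheet (h : η ∈ sheet γ U V) : η.right.as ∈ V :=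
  let ⟨_, _, _, hb, _⟩ := h
  hb.right_mem

lemma sheet_subset_of_mem (h : η ∈ sheet γ U V) : sheet η U V ⊆ sheet γ U V := by
  obtain ⟨a, b, ha, hb, e⟩ := h
  rintro ζ ⟨a', b', ha', hb', e'⟩
  exact ⟨a' ≫ a, b ≫ b', ha'.comp ha, hb.comp hb', by rw [e', e]; simp⟩

/-- With `sheet_subset_of_mem`, this shows that two sheets over the same `U` and `V` are equal or
disjoint. -/
lemma mem_sheet_comm (h : η ∈ sheet γ U V) : γ ∈ sheet η U V := by
  obtain ⟨a, b, ha, hb, e⟩ := h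
  exact ⟨Groupoid.inv a, Groupoid.inv b, ha.inv, hb.inv, by rw [e]; simp⟩

/-- An arrow in a sheet is determined by its endpoints. -/
lemma sheet_hom_injective (hU : IsElementary U) (hV : IsElementary V) {g h : x ⟶ y}
    (hg : Arrow.mk g ∈ sheet γ U V) (hh : Arrow.mk h ∈ sheet γ U V) : g = h := by
  obtain ⟨a, b, ha, hb, e⟩ := hg
  obtain ⟨a', b', ha', hb', e'⟩ := hh
  have e : g = a ≫ γ.hom ≫ b := e
  have e' : h = a' ≫ γ.hom ≫ b' := e'
  rw [e, e', hU.eq ha ha', hV.eq hb hb']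

lemma sheet_injOn (hU : IsElementary U) (hV : IsElementary V) :
    Set.InjOn (fun η : Arrow (FundamentalGroupoid X) => (η.left.as, η.right.as))
      (sheet γ U V) := by
  rintro ⟨⟨x⟩, ⟨y⟩, g⟩ hg ⟨⟨x'⟩, ⟨y'⟩, h⟩ hh e
  obtain ⟨rfl, rfl⟩ : x = x' ∧ y = y' := by simpa using e
  obtain rfl : g = h := sheet_hom_injective hU hV hg hh
  rfl

lemma exists_mem_sheet (hU : IsElementary U) (hV : IsElementary V) (hγU : γ.left.as ∈ U)
    (hγV : γ.right.as ∈ V) (hx : x.as ∈ U) (hy : y.as ∈ V) :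
    ∃ g : x ⟶ y, Arrow.mk g ∈ sheet γ U V := by
  obtain ⟨a, ha⟩ := hU.exists_supportedIn hx hγU
  obtain ⟨b, hb⟩ := hV.exists_supportedIn hγV hy
  exact ⟨a ≫ γ.hom ≫ b, a, b, ha, hb, rfl⟩

end Local

/-! ### Sheets and the quotient topology on path classes. -/

section Topology

variable {X : Type u} [TopologicalSpace X]

/-- The straight path between two points of the unit interval. -/
def segmentPath (s t : unitInterval) : Path s t where
  toFun r := ⟨(1 - r) * s + r * t, convex_Icc (0 : ℝ) 1 s.2 t.2 (by linarith [r.2.2]) r.2.1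
    (by ring)⟩
  continuous_toFun := by fun_prop
  source' := by simp
  target' := by simp

lemma segmentPath_mem_ball {s t c : unitInterval} {ε : ℝ} (hs : dist s c < ε)
    (ht : dist t c < ε) (r : unitInterval) : dist (segmentPath s t r) c < ε :=
  (convex_ball (c : ℝ) ε) (Metric.mem_ball.2 hs) (Metric.mem_ball.2 ht)
    (by linarith [r.2.2] : (0 : ℝ) ≤ 1 - r) r.2.1 (by ring)

/-- The interval is contractible. Pushing these homotopies forward along a path of `X` yields all
the reparametrization identities below. -/
lemma unitInterval_homotopic {s t : unitInterval} (p q : Path s t) : p.Homotopic q := by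
  have : ContractibleSpace unitInterval :=
    (convex_Icc (0 : ℝ) 1).contractibleSpace ⟨0, by simp⟩
  exact SimplyConnectedSpace.paths_homotopic p q

/-- The class of the piece of the path `q` between the parameters `s` and `t`. -/
noncomputable def pathSegment (q : C(unitInterval, X)) (s t : unitInterval) :
    FundamentalGroupoid.mk (q s) ⟶ FundamentalGroupoid.mk (q t) :=
  fromPath (.mk ((segmentPath s t).map q.continuous))

lemma pathSegment_comp (q : C(unitInterval, X)) (r s t : unitInterval) :
    pathSegment q r s ≫ pathSegment q s t = pathSegment q r t := by
  have h := (unitInterval_homotopic ((segmentPath r s).trans (segmentPath s t))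
    (segmentPath r t)).map q
  rw [Path.map_trans] at h
  exact Path.Homotopic.Quotient.eq.2 h

lemma pathSegment_self (q : C(unitInterval, X)) (s : unitInterval) :
    pathSegment q s s = 𝟙 _ := by
  have h := (unitInterval_homotopic (segmentPath s s) (Path.refl s)).map q
  exact Path.Homotopic.Quotient.eq.2 h

lemma pathClass_eq_mk_pathSegment (q : C(unitInterval, X)) :
    pathClass q = Arrow.mk (pathSegment q 0 1) := by
  have h := (unitInterval_homotopic (segmentPath 0 1) ⟨ContinuousMap.id _, rfl, rfl⟩).map q
  exact congrArg Arrow.mk (Path.Homotopic.Quotient.eq.2 h).symm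

lemma pathClass_toContinuousMap {x y : X} (p : Path x y) :
    pathClass p.toContinuousMap = Arrow.mk (fromPath (.mk p)) := by
  obtain ⟨p, rfl, rfl⟩ := p
  rfl

lemma exists_pathClass (γ : Arrow (FundamentalGroupoid X)) :
    ∃ (p : Path γ.left.as γ.right.as), γ.hom = fromPath (.mk p) ∧
      pathClass p.toContinuousMap = γ := by
  obtain ⟨p, hp⟩ := Path.Homotopic.Quotient.mk_surjective γ.hom
  exact ⟨p, hp.symm, by rw [pathClass_toContinuousMap, hp]; rfl⟩

lemma pathClass_surjective : Function.Surjective (pathClass (X := X)) :=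
  fun γ => let ⟨_, _, h⟩ := exists_pathClass γ; ⟨_, h⟩

lemma isQuotientMap_pathClass : IsQuotientMap (pathClass (X := X)) :=
  ⟨⟨rfl⟩, pathClass_surjective⟩

lemma continuous_pathClass : Continuous (pathClass (X := X)) :=
  isQuotientMap_pathClass.continuous

lemma continuous_left_as : Continuous fun γ : Arrow (FundamentalGroupoid X) => γ.left.as :=
  isQuotientMap_pathClass.continuous_iff.2 (continuous_eval_const (0 : unitInterval))

lemma continuous_right_as : Continuous fun γ : Arrow (FundamentalGroupoid X) => γ.right.as :=
  isQuotientMap_pathClass.continuous_iff.2 (continuous_eval_const (1 : unitInterval))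

/-- Every neighbourhood of an arrow contains a sheet around it. -/
lemma exists_sheet_subset {γ : Arrow (FundamentalGroupoid X)}
    {S : Set (Arrow (FundamentalGroupoid X))} (hS : S ∈ 𝓝 γ) :
    ∃ U ∈ 𝓝 γ.left.as, ∃ V ∈ 𝓝 γ.right.as, sheet γ U V ⊆ S := by
  obtain ⟨p, hp, -⟩ := exists_pathClass γ
  -- In the compact-open topology, every path with sufficiently small image around `z` is close to
  -- the constant path at `z`.
  have key (z : X) (N : Set C(unitInterval, X)) (hN : N ∈ 𝓝 (ContinuousMap.const unitInterval z)) :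
      ∃ U ∈ 𝓝 z, ∀ f : C(unitInterval, X), Set.range f ⊆ U → f ∈ N := by
    have ht : Filter.Tendsto id
        ((𝓝 z).smallSets.comap fun f : C(unitInterval, X) => Set.range f)
        (𝓝 (ContinuousMap.const unitInterval z)) := by
      rw [ContinuousMap.tendsto_nhds_compactOpen]
      intro K _ O hO hKO
      rcases K.eq_empty_or_nonempty with rfl | ⟨k, hk⟩
      · exact .of_forall fun f => Set.mapsTo_empty _ _
      · have hz : O ∈ 𝓝 z := hO.mem_nhds (hKO hk)
        filter_upwards [Filter.preimage_mem_comap (Filter.eventually_smallSets_subset.2 hz)]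
          with f hf t _
        exact hf ⟨t, rfl⟩
    obtain ⟨M, hM, hMN⟩ := Filter.mem_comap.1 (ht hN)
    obtain ⟨U, hU, hUM⟩ := Filter.eventually_smallSets.1 hM
    exact ⟨U, hU, fun f hf => hMN (hUM _ hf)⟩
  -- Pairs of paths that can be attached before and after `p`. Concatenation `F` is continuous on
  -- `T`, and the pair of constant paths is sent to a representative of `γ`.
  let T := {f : C(unitInterval, X) × C(unitInterval, X) //
    f.1 1 = γ.left.as ∧ f.2 0 = γ.right.as}
  let A (i : T) : Path (i.1.1 0) γ.left.as := ⟨i.1.1, rfl, i.2.1⟩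
  let B (i : T) : Path γ.right.as (i.1.2 1) := ⟨i.1.2, i.2.2, rfl⟩
  have hA : Continuous ↿A :=
    ((continuous_fst.comp continuous_subtype_val).comp continuous_fst).eval continuous_snd
  have hB : Continuous ↿B :=
    ((continuous_snd.comp continuous_subtype_val).comp continuous_fst).eval continuous_snd
  have hP : Continuous ↿fun _ : T => p := by
    change Continuous fun j : T × unitInterval => p j.2
    fun_prop
  have hF := Path.trans_continuous_family A hA _ (Path.trans_continuous_family _ hP B hB)
  let F : T → C(unitInterval, X) := fun i => ((A i).trans (p.trans (B i))).toContinuousMap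
  have hF' : Continuous F := ContinuousMap.continuous_of_continuous_uncurry _ hF
  have hFc (i : T) : pathClass (F i) =
      Arrow.mk (fromPath (.mk (A i)) ≫ fromPath (.mk p) ≫ fromPath (.mk (B i))) :=
    pathClass_toContinuousMap _
  let i₀ : T := ⟨(.const _ γ.left.as, .const _ γ.right.as), rfl, rfl⟩
  have hi₀ : pathClass (F i₀) = γ := by
    rw [hFc]
    change Arrow.mk (𝟙 γ.left ≫ fromPath (.mk p) ≫ 𝟙 γ.right) = γ
    rw [← hp, Category.id_comp, Category.comp_id]
    rfl
  have hmem : (fun i => pathClass (F i)) ⁻¹' S ∈ 𝓝 i₀ :=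
    (continuous_pathClass.comp hF').continuousAt (by rw [Function.comp_apply, hi₀]; exact hS)
  obtain ⟨N, hN, hNS⟩ := mem_nhds_subtype _ _ _ |>.1 hmem
  obtain ⟨N₁, hN₁, N₂, hN₂, hNN⟩ := mem_nhds_prod_iff.1 hN
  obtain ⟨U, hU, hUN⟩ := key _ _ hN₁
  obtain ⟨V, hV, hVN⟩ := key _ _ hN₂
  refine ⟨U, hU, V, hV, ?_⟩
  rintro ⟨x, y, h⟩ ⟨a, b, ⟨a, ha, rfl⟩, ⟨b, hb, rfl⟩, e⟩
  let i : T := ⟨(a.toContinuousMap, b.toContinuousMap), a.target, b.source⟩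
  have hi : pathClass (F i) ∈ S := hNS (hNN ⟨hUN _ ha, hVN _ hb⟩)
  have hFi : F i = (a.trans (p.trans b)).toContinuousMap := rfl
  rw [hFi, pathClass_toContinuousMap] at hi
  have e' : h = fromPath (.mk (a.trans (p.trans b))) := by
    rw [hp] at e
    exact e
  rw [e']
  exact hi

/-- Near `p`, the initial piece of a path up
to the parameter `t` is the corresponding piece of `p`, composed with short paths. -/
lemma eventually_pathSegment [LocallyPathConnectedSpace X] (hX : SemilocallySimplyConnected X)
    (p : C(unitInterval, X)) {U : Set X} (hU : U ∈ 𝓝 (p 0)) (t : unitInterval) :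
    ∀ W ∈ 𝓝 (p t), ∀ᶠ q : C(unitInterval, X) in 𝓝 p,
      ∃ (a : FundamentalGroupoid.mk (q 0) ⟶ .mk (p 0))
        (b : FundamentalGroupoid.mk (p t) ⟶ .mk (q t)),
        SupportedIn U a ∧ SupportedIn W b ∧ pathSegment q 0 t = a ≫ pathSegment p 0 t ≫ b := by
  -- The aim is that `P` holds on a clopen set of parameters containing `0`. Quantifying over `W`
  -- inside `P` lets the step from `s` to `t` use a different neighbourhood at each end.
  let P (t : unitInterval) : Prop := ∀ W ∈ 𝓝 (p t), ∀ᶠ q : C(unitInterval, X) in 𝓝 p,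
      ∃ (a : FundamentalGroupoid.mk (q 0) ⟶ .mk (p 0))
        (b : FundamentalGroupoid.mk (p t) ⟶ .mk (q t)),
        SupportedIn U a ∧ SupportedIn W b ∧ pathSegment q 0 t = a ≫ pathSegment p 0 t ≫ b
  have hev (t : unitInterval) : Filter.Tendsto (fun q : C(unitInterval, X) => q t) (𝓝 p)
      (𝓝 (p t)) := (continuous_eval_const t).continuousAt
  have h0 : P 0 := by
    intro W hW
    obtain ⟨Z, hZ, hpZ, hZW⟩ := exists_isElementary hX (Filter.inter_mem hU hW)
    filter_upwards [hev 0 (hZ.isOpen.mem_nhds hpZ)] with q hq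
    obtain ⟨a, ha⟩ := hZ.exists_supportedIn (x := .mk (q 0)) (y := .mk (p 0)) hq hpZ
    refine ⟨a, Groupoid.inv a, ha.mono fun z hz => (hZW hz).1,
      (ha.mono fun z hz => (hZW hz).2).inv, ?_⟩
    rw [pathSegment_self, pathSegment_self]
    simp
  -- Near `c` both `p` and nearby `q` run from `s` to `t` inside one elementary set `Z`, so the two
  -- routes from `p s` to `q t` agree. Taking `s = c` gives openness, taking `t = c` closedness.
  have hloc (c : unitInterval) : ∀ᶠ s in 𝓝 c, ∀ᶠ t in 𝓝 c, P s → P t := by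
    obtain ⟨Z, hZ, hpZ, -⟩ := exists_isElementary hX (Filter.univ_mem (f := 𝓝 (p c)))
    obtain ⟨ε, hε, hball⟩ := Metric.mem_nhds_iff.1
      (p.continuous.continuousAt (hZ.isOpen.mem_nhds hpZ))
    filter_upwards [Metric.ball_mem_nhds c hε] with s hs
    filter_upwards [Metric.ball_mem_nhds c hε] with t ht hPs W hW
    have hpseg : SupportedIn Z (pathSegment p s t) := by
      refine ⟨_, ?_, rfl⟩
      rintro _ ⟨r, rfl⟩
      exact hball (segmentPath_mem_ball hs ht r)
    obtain ⟨Z', hZ', hpZ', hZW'⟩ :=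
      exists_isElementary hX (Filter.inter_mem hW (hZ.isOpen.mem_nhds (hball ht)))
    have hK : ∀ᶠ q : C(unitInterval, X) in 𝓝 p, Set.MapsTo q (Set.range (segmentPath s t)) Z := by
      refine ContinuousMap.eventually_mapsTo (isCompact_range (segmentPath s t).continuous)
        hZ.isOpen ?_
      rintro _ ⟨r, rfl⟩
      exact hball (segmentPath_mem_ball hs ht r)
    filter_upwards [hPs Z (hZ.isOpen.mem_nhds (hball hs)), hK,
      hev t (hZ'.isOpen.mem_nhds hpZ')] with q ⟨a, b, ha, hb, e⟩ hqK hqt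
    obtain ⟨b', hb'⟩ := hZ'.exists_supportedIn (x := .mk (p t)) (y := .mk (q t)) hpZ' hqt
    refine ⟨a, b', ha, hb'.mono fun z hz => (hZW' hz).1, ?_⟩
    have hqseg : SupportedIn Z (pathSegment q s t) := by
      refine ⟨_, ?_, rfl⟩
      rintro _ ⟨r, rfl⟩
      exact hqK ⟨r, rfl⟩
    have key : b ≫ pathSegment q s t = pathSegment p s t ≫ b' :=
      hZ.eq (hb.comp hqseg) (hpseg.comp (hb'.mono fun z hz => (hZW' hz).2))
    rw [← pathSegment_comp q 0 s t, e, ← pathSegment_comp p 0 s t]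
    simp only [Category.assoc, key]
  have hclopen : IsClopen {t | P t} := by
    refine ⟨⟨isOpen_iff_mem_nhds.2 fun c hc => ?_⟩, isOpen_iff_mem_nhds.2 fun c hc => ?_⟩
    · filter_upwards [hloc c] with s hs hPs using hc (hs.self_of_nhds hPs)
    · filter_upwards [(hloc c).self_of_nhds] with t ht using ht hc
  have huniv : {t | P t} = Set.univ := hclopen.eq_univ ⟨0, h0⟩
  exact (huniv.symm ▸ Set.mem_univ t : t ∈ {t | P t})

lemma isOpen_sheet [LocallyPathConnectedSpace X] (hX : SemilocallySimplyConnected X)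
    (γ : Arrow (FundamentalGroupoid X)) {U V : Set X} (hU : IsOpen U) (hV : IsOpen V) :
    IsOpen (sheet γ U V) := by
  rw [← isQuotientMap_pathClass.isOpen_preimage, isOpen_iff_mem_nhds]
  intro p hp
  filter_upwards [eventually_pathSegment hX p (hU.mem_nhds (left_mem_of_mem_sheet hp)) 1 V
    (hV.mem_nhds (right_mem_of_mem_sheet hp))] with q ⟨a, b, ha, hb, e⟩
  refine sheet_subset_of_mem hp ?_
  rw [pathClass_eq_mk_pathSegment q, pathClass_eq_mk_pathSegment p]
  exact ⟨a, b, ha, hb, e⟩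

/-- The sheets over elementary open sets form a neighbourhood basis. -/
lemma mem_nhds_iff_sheet [LocallyPathConnectedSpace X] (hX : SemilocallySimplyConnected X)
    {γ : Arrow (FundamentalGroupoid X)} {S : Set (Arrow (FundamentalGroupoid X))} :
    S ∈ 𝓝 γ ↔ ∃ U V, IsElementary U ∧ IsElementary V ∧ γ.left.as ∈ U ∧ γ.right.as ∈ V ∧
      sheet γ U V ⊆ S := by
  constructor
  · intro hS
    obtain ⟨U, hU, V, hV, hS⟩ := exists_sheet_subset hS
    obtain ⟨U', hU', hγU, hUU⟩ := exists_isElementary hX hU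
    obtain ⟨V', hV', hγV, hVV⟩ := exists_isElementary hX hV
    exact ⟨U', V', hU', hV', hγU, hγV, (sheet_mono hUU hVV).trans hS⟩
  · rintro ⟨U, V, hU, hV, hγU, hγV, hS⟩
    exact Filter.mem_of_superset
      ((isOpen_sheet hX γ hU.isOpen hV.isOpen).mem_nhds (mem_sheet_self hγU hγV)) hS

end Topology

end FundamentalGroupoid

namespace FundamentalGroupoid

/-! ### The topological groupoid and its charts. -/

section TopologicalGroupoid

variable {X : Type u} [TopologicalSpace X]

lemma continuous_unit : Continuous fun x : X => Arrow.mk (𝟙 (FundamentalGroupoid.mk x)) :=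
  continuous_pathClass.comp
    (ContinuousMap.continuous_of_continuous_uncurry (fun x : X => ContinuousMap.const unitInterval x)
      continuous_fst)

/-- The space of units of the fundamental groupoid is the space itself. -/
def unitHomeomorph : FundamentalGroupoid X ≃ₜ X where
  toEquiv := FundamentalGroupoid.equiv X
  continuous_toFun := continuous_left_as.comp
    (continuous_induced_dom (f := fun x : FundamentalGroupoid X => Arrow.mk (𝟙 x)))
  continuous_invFun := continuous_induced_rng.2 continuous_unit

lemma continuous_left : Continuous fun γ : Arrow (FundamentalGroupoid X) => γ.left :=
  unitHomeomorph.symm.continuous.comp continuous_left_as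

lemma continuous_right : Continuous fun γ : Arrow (FundamentalGroupoid X) => γ.right :=
  unitHomeomorph.symm.continuous.comp continuous_right_as

lemma continuous_arrowInv :
    Continuous (arrowInv : Arrow (FundamentalGroupoid X) → Arrow (FundamentalGroupoid X)) := by
  refine isQuotientMap_pathClass.continuous_iff.2 ?_
  let r : C(unitInterval, unitInterval) := ⟨unitInterval.symm, unitInterval.continuous_symm⟩
  have h : Continuous fun p : C(unitInterval, X) => pathClass (p.comp r) :=
    continuous_pathClass.comp (ContinuousMap.continuous_precomp r)
  refine h.congr fun p => ?_
  let q : Path (p 0) (p 1) := ⟨p, rfl, rfl⟩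
  exact pathClass_toContinuousMap q.symm

lemma arrowMul_mk {C : Type u} [Groupoid.{v} C] {x y z : C} (h : x ⟶ y) (g : y ⟶ z) :
    arrowMul (Arrow.mk g) (Arrow.mk h) rfl = Arrow.mk (h ≫ g) := by
  simp [arrowMul]

variable [LocallyPathConnectedSpace X]

/-- A product of quotient maps need not be a quotient map, so continuity is checked on sheets: the
short pieces meeting at the middle object form a loop in the elementary set `V`, and cancel. -/
lemma continuous_arrowMul (hX : SemilocallySimplyConnected X) : Continuous
    (fun p : {p : Arrow (FundamentalGroupoid X) × Arrow (FundamentalGroupoid X) //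
      p.2.right = p.1.left} => arrowMul p.1.1 p.1.2 p.2) := by
  rw [continuous_iff_continuousAt]
  rintro ⟨⟨⟨y, z, g⟩, ⟨x, y', h⟩⟩, hyy : y' = y⟩ S hS
  subst hyy
  change S ∈ 𝓝 (arrowMul (Arrow.mk g) (Arrow.mk h) rfl) at hS
  rw [arrowMul_mk] at hS
  obtain ⟨U, W, hU, hW, hxU, hzW, hUW⟩ := (mem_nhds_iff_sheet hX).1 hS
  obtain ⟨V, hV, hyV, -⟩ := exists_isElementary hX (Filter.univ_mem (f := 𝓝 y'.as))
  have hg : sheet (Arrow.mk g) V W ∈ 𝓝 (Arrow.mk g) :=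
    (mem_nhds_iff_sheet hX).2 ⟨V, W, hV, hW, hyV, hzW, subset_rfl⟩
  have hh : sheet (Arrow.mk h) U V ∈ 𝓝 (Arrow.mk h) :=
    (mem_nhds_iff_sheet hX).2 ⟨U, V, hU, hV, hxU, hyV, subset_rfl⟩
  refine Filter.mem_map.2 (mem_nhds_subtype _ _ _ |>.2 ⟨_, prod_mem_nhds hg hh, ?_⟩)
  rintro ⟨⟨⟨v, w, g'⟩, ⟨u, v', h'⟩⟩, hvv : v' = v⟩ ⟨⟨a, b, ha, hb, e⟩, ⟨a', b', ha', hb', e'⟩⟩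
  subst hvv
  refine hUW ?_
  change arrowMul (Arrow.mk g') (Arrow.mk h') rfl ∈ _
  rw [arrowMul_mk]
  refine ⟨a', b, ha', hb, ?_⟩
  have hab : b' ≫ a = 𝟙 _ := hV.eq (hb'.comp ha) (.id hyV)
  change h' = a' ≫ h ≫ b' at e'
  change g' = a ≫ g ≫ b at e
  change h' ≫ g' = a' ≫ (h ≫ g) ≫ b
  rw [e, e']
  simp only [Category.assoc, reassoc_of% hab]

lemma isTopologicalGroupoid (hX : SemilocallySimplyConnected X) :
    IsTopologicalGroupoid (FundamentalGroupoid X) :=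
  ⟨continuous_left, continuous_right, continuous_arrowInv, continuous_arrowMul hX⟩

lemma t2Space_arrow [T2Space X] (hX : SemilocallySimplyConnected X) :
    T2Space (Arrow (FundamentalGroupoid X)) := by
  refine ⟨fun γ η hne => ?_⟩
  by_cases hl : γ.left.as = η.left.as
  · by_cases hr : γ.right.as = η.right.as
    · obtain ⟨U, hU, hxU, -⟩ := exists_isElementary hX (Filter.univ_mem (f := 𝓝 γ.left.as))
      obtain ⟨V, hV, hyV, -⟩ := exists_isElementary hX (Filter.univ_mem (f := 𝓝 γ.right.as))
      refine ⟨sheet γ U V, sheet η U V, isOpen_sheet hX _ hU.isOpen hV.isOpen,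
        isOpen_sheet hX _ hU.isOpen hV.isOpen, mem_sheet_self hxU hyV,
        mem_sheet_self (hl ▸ hxU) (hr ▸ hyV), Set.disjoint_left.2 fun ζ h₁ h₂ => hne ?_⟩
      -- A common element `ζ` would have both `γ` and `η` in its sheet, with equal endpoints.
      exact sheet_injOn hU hV (mem_sheet_comm h₁) (mem_sheet_comm h₂) (Prod.ext hl hr)
    · obtain ⟨A, B, hA, hB, h₁, h₂, hAB⟩ := t2_separation hr
      exact ⟨_, _, hA.preimage continuous_right_as, hB.preimage continuous_right_as, h₁, h₂,
        hAB.preimage _⟩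
  · obtain ⟨A, B, hA, hB, h₁, h₂, hAB⟩ := t2_separation hl
    exact ⟨_, _, hA.preimage continuous_left_as, hB.preimage continuous_left_as, h₁, h₂,
      hAB.preimage _⟩

lemma isOpenMap_endpoints (hX : SemilocallySimplyConnected X) :
    IsOpenMap fun γ : Arrow (FundamentalGroupoid X) => (γ.left.as, γ.right.as) := by
  refine isOpenMap_iff_nhds_le.2 fun γ => Filter.le_map fun S hS => ?_
  obtain ⟨U, V, hU, hV, hγU, hγV, hS⟩ := (mem_nhds_iff_sheet hX).1 hS
  refine Filter.mem_of_superset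
    (prod_mem_nhds (hU.isOpen.mem_nhds hγU) (hV.isOpen.mem_nhds hγV)) ?_
  rintro ⟨x, y⟩ ⟨hx, hy⟩
  obtain ⟨g, hg⟩ := exists_mem_sheet (x := .mk x) (y := .mk y) hU hV hγU hγV hx hy
  exact ⟨Arrow.mk g, hS hg, rfl⟩

/-- Sheets over elementary open sets are charts of the fundamental groupoid. -/
lemma isOpenEmbedding_sheet (hX : SemilocallySimplyConnected X)
    (γ : Arrow (FundamentalGroupoid X)) {U V : Set X} (hU : IsElementary U)
    (hV : IsElementary V) :
    IsOpenEmbedding fun η : sheet γ U V => (η.1.left.as, η.1.right.as) := by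
  refine .of_continuous_injective_isOpenMap ?_ ?_ ?_
  · exact (continuous_left_as.prodMk continuous_right_as).comp continuous_subtype_val
  · exact fun η ζ h => Subtype.ext (sheet_injOn hU hV η.2 ζ.2 h)
  · exact (isOpenMap_endpoints hX).comp
      (isOpen_sheet hX γ hU.isOpen hV.isOpen).isOpenMap_subtype_val

lemma locallyCompactSpace_arrow [LocallyCompactSpace X] (hX : SemilocallySimplyConnected X) :
    LocallyCompactSpace (Arrow (FundamentalGroupoid X)) := by
  refine ⟨fun γ S hS => ?_⟩
  obtain ⟨U, V, hU, hV, hγU, hγV, hUV⟩ := (mem_nhds_iff_sheet hX).1 hS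
  have hopen := isOpen_sheet hX γ hU.isOpen hV.isOpen
  have := (isOpenEmbedding_sheet hX γ hU hV).locallyCompactSpace
  obtain ⟨K, hK, -, hKc⟩ := LocallyCompactSpace.local_compact_nhds
    (⟨γ, mem_sheet_self hγU hγV⟩ : sheet γ U V) Set.univ Filter.univ_mem
  refine ⟨Subtype.val '' K, hopen.isOpenMap_subtype_val.image_mem_nhds hK, ?_,
    hKc.image continuous_subtype_val⟩
  rintro _ ⟨η, -, rfl⟩
  exact hUV η.2

/-- The arrows form a Lindelöf space, as a continuous image of the second countable path space, so
countably many sheets cover; each embeds in `X × X`. -/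
lemma secondCountableTopology_arrow [SecondCountableTopology X]
    (hX : SemilocallySimplyConnected X) :
    SecondCountableTopology (Arrow (FundamentalGroupoid X)) := by
  have hex (γ : Arrow (FundamentalGroupoid X)) :
      ∃ U V, IsElementary U ∧ IsElementary V ∧ γ ∈ sheet γ U V := by
    obtain ⟨U, V, hU, hV, h₁, h₂, -⟩ := (mem_nhds_iff_sheet hX).1 (Filter.univ_mem (f := 𝓝 γ))
    exact ⟨U, V, hU, hV, mem_sheet_self h₁ h₂⟩
  choose U V hU hV hmem using hex
  have hopen γ := isOpen_sheet hX γ (hU γ).isOpen (hV γ).isOpen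
  have hL : IsLindelof (Set.univ : Set (Arrow (FundamentalGroupoid X))) := by
    rw [← pathClass_surjective.range_eq, ← Set.image_univ]
    exact isLindelof_univ.image continuous_pathClass
  obtain ⟨t, htc, -, ht⟩ := hL.elim_nhds_subcover (fun γ => sheet γ (U γ) (V γ))
    fun γ _ => (hopen γ).mem_nhds (hmem γ)
  have := htc.to_subtype
  have (γ : t) : SecondCountableTopology (sheet γ.1 (U γ.1) (V γ.1)) :=
    (isOpenEmbedding_sheet hX γ.1 (hU γ.1) (hV γ.1)).isEmbedding.secondCountableTopology
  refine TopologicalSpace.secondCountableTopology_of_countable_cover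
    (U := fun γ : t => sheet γ.1 (U γ.1) (V γ.1)) (fun γ => hopen γ.1) ?_
  rw [← Set.univ_subset_iff]
  simpa only [Set.iUnion_coe_set] using ht

end TopologicalGroupoid

end FundamentalGroupoid

namespace FundamentalGroupoid

open scoped ENNReal

/-! ### The lifted measures and the Haar system. -/

section Haar

variable {X : Type u} [TopologicalSpace X]

/-- Given weights `c n` on points `d n` of `X`, the measure on the arrows with range `x` obtained
by lifting the measure `∑ n, c n • δ_{d n}` along the source map `G^x → X`. -/
noncomputable def liftMeasure (c : ℕ → ℝ≥0∞) (d : ℕ → X) (x : FundamentalGroupoid X) :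
    Measure (Arrow (FundamentalGroupoid X)) :=
  .sum fun n => c n • .sum fun g : FundamentalGroupoid.mk (d n) ⟶ x => .dirac (Arrow.mk g)

variable {c : ℕ → ℝ≥0∞} {d : ℕ → X} {x : FundamentalGroupoid X}

lemma liftMeasure_apply {A : Set (Arrow (FundamentalGroupoid X))} (hA : MeasurableSet A) :
    liftMeasure c d x A = ∑' n, c n * ∑' g : FundamentalGroupoid.mk (d n) ⟶ x,
      A.indicator 1 (Arrow.mk g) := by
  simp only [liftMeasure, Measure.sum_apply _ hA, Measure.smul_apply, smul_eq_mul,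
    Measure.dirac_apply' _ hA]

lemma isClosed_rangeFibre [T1Space X] (x : FundamentalGroupoid X) : IsClosed (rangeFibre x) := by
  convert! (isClosed_singleton (x := x.as)).preimage (continuous_right_as (X := X)) using 1
  ext γ
  exact FundamentalGroupoid.ext_iff

lemma liftMeasure_compl_rangeFibre [T1Space X] : liftMeasure c d x (rangeFibre x)ᶜ = 0 := by
  rw [liftMeasure_apply (isClosed_rangeFibre x).isOpen_compl.measurableSet]
  simp [rangeFibre]

lemma ae_liftMeasure_right_eq [T1Space X] : ∀ᵐ η ∂(liftMeasure c d x), η.right = x :=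
  liftMeasure_compl_rangeFibre

lemma t2Space_unit [T2Space X] : T2Space (FundamentalGroupoid X) :=
  unitHomeomorph.symm.t2Space

lemma hasCompactSupport_integral_liftMeasure [T2Space X]
    {f : Arrow (FundamentalGroupoid X) → ℂ} (hfc : HasCompactSupport f) :
    HasCompactSupport fun x : FundamentalGroupoid X => ∫ η, f η ∂(liftMeasure c d x) := by
  have := t2Space_unit (X := X)
  refine .intro (hfc.isCompact.image continuous_right) fun x hx => integral_eq_zero_of_ae ?_
  filter_upwards [ae_liftMeasure_right_eq] with η hη
  by_contra h
  exact hx ⟨η, subset_tsupport f h, hη⟩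

variable [LocallyPathConnectedSpace X]

/-- A sheet contains at most one arrow from `d n` to `x`, so each weight counts at most once. -/
lemma liftMeasure_sheet_le (hX : SemilocallySimplyConnected X)
    (γ : Arrow (FundamentalGroupoid X)) {U V : Set X} (hU : IsElementary U)
    (hV : IsElementary V) : liftMeasure c d x (sheet γ U V) ≤ ∑' n, c n := by
  rw [liftMeasure_apply (isOpen_sheet hX γ hU.isOpen hV.isOpen).measurableSet]
  refine ENNReal.tsum_le_tsum fun n => mul_le_of_le_one_right' ?_
  by_cases h : ∃ g : FundamentalGroupoid.mk (d n) ⟶ x, Arrow.mk g ∈ sheet γ U V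
  · obtain ⟨g, hg⟩ := h
    rw [tsum_eq_single g fun k hk => Set.indicator_of_notMem
      (fun hk' => hk (sheet_hom_injective hU hV hk' hg)) _]
    exact Set.indicator_le_self' (fun _ _ => zero_le) _
  · push Not at h
    simp [Set.indicator_of_notMem (h _)]

lemma isLocallyFiniteMeasure_liftMeasure (hX : SemilocallySimplyConnected X)
    (hc : ∑' n, c n ≠ ∞) : IsLocallyFiniteMeasure (liftMeasure c d x) := by
  refine ⟨fun γ => ?_⟩
  obtain ⟨U, V, hU, hV, h₁, h₂, -⟩ := (mem_nhds_iff_sheet hX).1 (Filter.univ_mem (f := 𝓝 γ))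
  exact ⟨sheet γ U V, (mem_nhds_iff_sheet hX).2 ⟨U, V, hU, hV, h₁, h₂, subset_rfl⟩,
    (liftMeasure_sheet_le hX γ hU hV).trans_lt hc.lt_top⟩

/-- Some `d n` lies in the source set of any sheet around `γ`, and lifts to an atom of mass `c n` in
it. -/
lemma support_liftMeasure [T1Space X] (hX : SemilocallySimplyConnected X) (hd : DenseRange d)
    (hc : ∀ n, 0 < c n) (x : FundamentalGroupoid X) :
    (liftMeasure c d x).support = rangeFibre x := by
  refine Set.Subset.antisymm (fun γ hγ => ?_) fun γ hγ => ?_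
  · by_contra h
    refine Measure.notMem_support_iff_exists.2 ⟨(rangeFibre x)ᶜ, ?_,
      liftMeasure_compl_rangeFibre⟩ hγ
    exact (isClosed_rangeFibre x).isOpen_compl.mem_nhds h
  · obtain rfl : γ.right = x := hγ
    refine (Measure.mem_support_iff_forall γ).2 fun S hS => ?_
    obtain ⟨U, V, hU, hV, h₁, h₂, hS⟩ := (mem_nhds_iff_sheet hX).1 hS
    refine lt_of_lt_of_le ?_ (measure_mono hS)
    obtain ⟨n, hn⟩ := hd.exists_mem_open hU.isOpen ⟨_, h₁⟩
    obtain ⟨g, hg⟩ := exists_mem_sheet (x := .mk (d n)) (y := γ.right) hU hV h₁ h₂ hn h₂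
    rw [liftMeasure_apply (isOpen_sheet hX γ hU.isOpen hV.isOpen).measurableSet]
    calc 0 < c n * 1 := by simpa using hc n
      _ ≤ c n * ∑' g : FundamentalGroupoid.mk (d n) ⟶ γ.right,
          (sheet γ U V).indicator 1 (Arrow.mk g) := by
        gcongr
        exact le_of_eq_of_le (by simp [hg]) (ENNReal.le_tsum g)
      _ ≤ _ := ENNReal.le_tsum (f := fun n => c n * ∑' g : FundamentalGroupoid.mk (d n) ⟶ γ.right,
          (sheet γ U V).indicator 1 (Arrow.mk g)) n

lemma continuous_leftTranslate (hX : SemilocallySimplyConnected X)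
    (γ : Arrow (FundamentalGroupoid X)) :
    Continuous fun η : rangeFibre γ.left => arrowMul γ η.1 η.2 :=
  (continuous_arrowMul hX).comp
    ((continuous_const.prodMk continuous_subtype_val).subtype_mk fun η : rangeFibre γ.left => η.2)

/-- Composition with `γ` is a bijection between the arrows out of `d n` ending at its source and
those ending at its range. -/
lemma map_leftTranslate_liftMeasure [T1Space X] (hX : SemilocallySimplyConnected X)
    (γ : Arrow (FundamentalGroupoid X)) :
    ((liftMeasure c d γ.left).comap Subtype.val).map
      (fun η : rangeFibre γ.left => arrowMul γ η.1 η.2) = liftMeasure c d γ.right := by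
  have hm := (continuous_leftTranslate hX γ).measurable
  have he := MeasurableEmbedding.subtype_coe (isClosed_rangeFibre γ.left).measurableSet
  ext A hA
  rw [Measure.map_apply hm hA, he.comap_apply,
    liftMeasure_apply (he.measurableSet_image.2 (hm hA)), liftMeasure_apply hA]
  congr! 3 with n
  let e : (FundamentalGroupoid.mk (d n) ⟶ γ.left) ≃ (FundamentalGroupoid.mk (d n) ⟶ γ.right) :=
    { toFun g := g ≫ γ.hom
      invFun g := g ≫ Groupoid.inv γ.hom
      left_inv g := by simp
      right_inv g := by simp }
  rw [← e.tsum_eq]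
  refine tsum_congr fun g => ?_
  have hmul : arrowMul γ (Arrow.mk g) rfl = Arrow.mk (e g) := arrowMul_mk g γ.hom
  refine Set.indicator_eq_indicator ?_ rfl
  rw [← hmul]
  constructor
  · rintro ⟨⟨_, _⟩, h, rfl⟩
    exact h
  · exact fun h => ⟨⟨Arrow.mk g, rfl⟩, h, rfl⟩

lemma integral_leftTranslate_liftMeasure [T1Space X] [SecondCountableTopology X]
    (hX : SemilocallySimplyConnected X) {f : Arrow (FundamentalGroupoid X) → ℂ}
    (hf : Continuous f) (γ : Arrow (FundamentalGroupoid X)) :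
    ∫ η : rangeFibre γ.left, f (arrowMul γ η.1 η.2)
      ∂((liftMeasure c d γ.left).comap Subtype.val) = ∫ η, f η ∂(liftMeasure c d γ.right) := by
  rw [← map_leftTranslate_liftMeasure hX γ,
    integral_map (continuous_leftTranslate hX γ).aemeasurable hf.aestronglyMeasurable]

/-- Near a unit `x₀`, the range map on the arrows with source `x₀` has a continuous section. -/
lemma exists_section [PathConnectedSpace X] (hX : SemilocallySimplyConnected X)
    (x₀ : FundamentalGroupoid X) : ∃ s : ∀ x, x₀ ⟶ x,
      Filter.Tendsto (fun x => Arrow.mk (s x)) (𝓝 x₀) (𝓝 (Arrow.mk (𝟙 x₀))) := by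
  obtain ⟨U, hU, hxU, -⟩ := exists_isElementary hX (Filter.univ_mem (f := 𝓝 x₀.as))
  -- Outside `U` the choice is arbitrary; path connectedness only makes `s` total.
  have hex (x : FundamentalGroupoid X) : ∃ h : x₀ ⟶ x, x.as ∈ U → SupportedIn U h := by
    by_cases hx : x.as ∈ U
    · obtain ⟨h, hh⟩ := hU.exists_supportedIn hxU hx
      exact ⟨h, fun _ => hh⟩
    · exact ⟨fromPath (.mk (PathConnectedSpace.somePath _ _)), fun h => (hx h).elim⟩
  choose s hs using hex
  refine ⟨s, fun S hS => ?_⟩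
  obtain ⟨U', V', hU', hV', h₁, h₂, hS⟩ := (mem_nhds_iff_sheet hX).1 hS
  obtain ⟨W, hW, hxW, hWU⟩ := exists_isElementary hX
    (Filter.inter_mem (hU.isOpen.mem_nhds hxU) (hV'.isOpen.mem_nhds h₂))
  have hWx : ∀ᶠ x : FundamentalGroupoid X in 𝓝 x₀, x.as ∈ W :=
    unitHomeomorph.continuous.continuousAt (hW.isOpen.mem_nhds hxW)
  refine Filter.mem_map.2 ?_
  filter_upwards [hWx] with x hx
  obtain ⟨h, hh⟩ := hW.exists_supportedIn (y := x) hxW hx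
  -- Uniqueness in `U` identifies `s x` with an arrow supported in the smaller set `W`, which forces
  -- convergence to the unit.
  have hsx : s x = h := hU.eq (hs x (hWU hx).1) (hh.mono fun z hz => (hWU hz).1)
  refine hS ⟨𝟙 _, s x, .id h₁, ?_, ?_⟩
  · rw [hsx]
    exact hh.mono fun z hz => (hWU hz).2
  · simp

/-- The product of two compact sets of arrows is compact. -/
lemma isCompact_image_arrowMul [T2Space X] (hX : SemilocallySimplyConnected X)
    {K L : Set (Arrow (FundamentalGroupoid X))} (hK : IsCompact K) (hL : IsCompact L) :
    IsCompact ((fun p : {p : Arrow (FundamentalGroupoid X) × Arrow (FundamentalGroupoid X) //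
      p.2.right = p.1.left} => arrowMul p.1.1 p.1.2 p.2) '' (Subtype.val ⁻¹' K ×ˢ L)) := by
  have := t2Space_unit (X := X)
  have hcl : IsClosed {p : Arrow (FundamentalGroupoid X) × Arrow (FundamentalGroupoid X) |
      p.2.right = p.1.left} :=
    isClosed_eq (continuous_right.comp continuous_snd) (continuous_left.comp continuous_fst)
  exact (hcl.isClosedEmbedding_subtypeVal.isCompact_preimage (hK.prod hL)).image
    (continuous_arrowMul hX)

lemma arrowInv_mul_cancel {C : Type u} [Groupoid.{v} C] {γ η : Arrow C} (h : η.right = γ.left) :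
    arrowMul (arrowInv γ) (arrowMul γ η h) rfl = η := by
  obtain ⟨y, z, g⟩ := γ
  obtain ⟨x, y', k⟩ := η
  obtain rfl : y' = y := h
  simp [arrowMul, arrowInv]
  rfl

lemma continuous_integral_liftMeasure [PathConnectedSpace X] [T2Space X] [LocallyCompactSpace X]
    [SecondCountableTopology X] (hX : SemilocallySimplyConnected X) (hc : ∑' n, c n ≠ ∞)
    {f : Arrow (FundamentalGroupoid X) → ℂ} (hf : Continuous f) (hfc : HasCompactSupport f) :
    Continuous fun x : FundamentalGroupoid X => ∫ η, f η ∂(liftMeasure c d x) := by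
  have := locallyCompactSpace_arrow hX
  have hfin (x : FundamentalGroupoid X) : IsLocallyFiniteMeasure (liftMeasure c d x) :=
    isLocallyFiniteMeasure_liftMeasure hX hc
  -- Dominated convergence along `𝓝 x₀` needs a countably generated filter.
  have : FirstCountableTopology (FundamentalGroupoid X) :=
    unitHomeomorph.isInducing.firstCountableTopology
  refine continuous_iff_continuousAt.2 fun x₀ => ?_
  obtain ⟨s, hs⟩ := exists_section hX x₀
  have htr (h : Σ x, x₀ ⟶ x) : ∫ η : rangeFibre x₀, f (arrowMul (Arrow.mk h.2) η.1 η.2)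
      ∂((liftMeasure c d x₀).comap Subtype.val) = ∫ η, f η ∂(liftMeasure c d h.1) :=
    integral_leftTranslate_liftMeasure hX hf (Arrow.mk h.2)
  obtain ⟨M, hM⟩ := hfc.exists_bound_of_continuous hf
  -- If `f (s x · η) ≠ 0` with `(s x)⁻¹ ∈ K`, then `η = (s x)⁻¹ (s x · η)` lies in the compact set
  -- `L = K · tsupport f`. Hence `M` times the indicator of `L` is an integrable bound independent
  -- of `x`.
  obtain ⟨K, hK, hK₁⟩ := exists_compact_mem_nhds (arrowInv (Arrow.mk (𝟙 x₀)))
  have hsK : ∀ᶠ x in 𝓝 x₀, arrowInv (Arrow.mk (s x)) ∈ K :=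
    ((continuous_arrowInv.tendsto _).comp hs) hK₁
  have hL := isCompact_image_arrowMul hX hK hfc.isCompact
  set L := (fun p : {p : Arrow (FundamentalGroupoid X) × Arrow (FundamentalGroupoid X) //
    p.2.right = p.1.left} => arrowMul p.1.1 p.1.2 p.2) '' (Subtype.val ⁻¹' K ×ˢ tsupport f)
  have he := MeasurableEmbedding.subtype_coe (isClosed_rangeFibre x₀).measurableSet
  have := t2Space_arrow hX
  have hLm : MeasurableSet (Subtype.val ⁻¹' L : Set (rangeFibre x₀)) :=
    measurable_subtype_coe hL.measurableSet
  have hLfin : (liftMeasure c d x₀).comap Subtype.val (Subtype.val ⁻¹' L : Set (rangeFibre x₀))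
      ≠ ∞ := by
    rw [he.comap_apply]
    exact ((measure_mono (Set.image_preimage_subset _ _)).trans_lt hL.measure_lt_top).ne
  have key : Filter.Tendsto (fun x => ∫ η : rangeFibre x₀, f (arrowMul (Arrow.mk (s x)) η.1 η.2)
      ∂((liftMeasure c d x₀).comap Subtype.val)) (𝓝 x₀)
      (𝓝 (∫ η : rangeFibre x₀, f (arrowMul (Arrow.mk (𝟙 x₀)) η.1 η.2)
        ∂((liftMeasure c d x₀).comap Subtype.val))) := by
    refine tendsto_integral_filter_of_dominated_convergence
      ((Subtype.val ⁻¹' L).indicator fun _ => M) ?_ ?_ ?_ ?_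
    · exact .of_forall fun x =>
        (hf.comp (continuous_leftTranslate hX (Arrow.mk (s x)))).aestronglyMeasurable
    · filter_upwards [hsK] with x hx
      refine .of_forall fun η => ?_
      by_cases hη : η.1 ∈ L
      · rw [Set.indicator_of_mem (Set.mem_preimage.2 hη)]
        exact hM _
      · have h0 : f (arrowMul (Arrow.mk (s x)) η.1 η.2) = 0 :=
          image_eq_zero_of_notMem_tsupport fun hmem =>
            hη ⟨⟨(_, _), rfl⟩, ⟨hx, hmem⟩, arrowInv_mul_cancel _⟩
        rw [Set.indicator_of_notMem (Set.mem_preimage.not.2 hη), h0, norm_zero]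
    · exact (integrable_indicator_iff hLm).2 (integrableOn_const hLfin)
    · refine .of_forall fun η => (hf.tendsto _).comp ?_
      have hpair : Filter.Tendsto
          (fun x => (⟨(Arrow.mk (s x), η.1), η.2⟩ : {p : Arrow (FundamentalGroupoid X) ×
            Arrow (FundamentalGroupoid X) // p.2.right = p.1.left})) (𝓝 x₀)
          (𝓝 ⟨(Arrow.mk (𝟙 x₀), η.1), η.2⟩) :=
        tendsto_subtype_rng.2 (hs.prodMk_nhds tendsto_const_nhds)
      exact ((continuous_arrowMul hX).tendsto _).comp hpair
  rw [htr ⟨x₀, 𝟙 x₀⟩] at key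
  exact key.congr fun x => htr ⟨x, s x⟩

/-- A sequence of weights on a dense sequence of points induces a Haar system. -/
noncomputable def haarSystem [PathConnectedSpace X] [T2Space X] [LocallyCompactSpace X]
    [SecondCountableTopology X] (hX : SemilocallySimplyConnected X) (hd : DenseRange d)
    (hc₀ : ∀ n, 0 < c n) (hc : ∑' n, c n ≠ ∞) : HaarSystem (FundamentalGroupoid X) where
  measure := liftMeasure c d
  regular x := by
    have := t2Space_arrow hX
    have := locallyCompactSpace_arrow hX
    have := secondCountableTopology_arrow hX
    have := isLocallyFiniteMeasure_liftMeasure (d := d) (x := x) hX hc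
    infer_instance
  support_eq := support_liftMeasure hX hd hc₀
  continuous_integral _ hf hfc := continuous_integral_liftMeasure hX hc hf hfc
  hasCompactSupport_integral _ _ hfc := hasCompactSupport_integral_liftMeasure hfc
  left_invariant _ hf _ γ := integral_leftTranslate_liftMeasure hX hf γ

end Haar

end FundamentalGroupoid

theorem mainTheorem4 (X : Type u) [TopologicalSpace X] [PathConnectedSpace X]
    [LocallyPathConnectedSpace X] (hX : SemilocallySimplyConnected X) [LocallyCompactSpace X]
    [T2Space X] [SecondCountableTopology X] :
    IsTopologicalGroupoid (FundamentalGroupoid X) ∧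
      LocallyCompactSpace (Arrow (FundamentalGroupoid X)) ∧
      T2Space (Arrow (FundamentalGroupoid X)) ∧
      Nonempty (HaarSystem (FundamentalGroupoid X)) := by
  -- Positive weights give full support; a finite sum gives local finiteness.
  obtain ⟨c, hc₀, hc⟩ := ENNReal.exists_pos_sum_of_countable' one_ne_zero ℕ
  exact ⟨FundamentalGroupoid.isTopologicalGroupoid hX,
    FundamentalGroupoid.locallyCompactSpace_arrow hX, FundamentalGroupoid.t2Space_arrow hX,
    ⟨FundamentalGroupoid.haarSystem hX (TopologicalSpace.denseRange_denseSeq X) hc₀ hc.ne_top⟩⟩
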